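/- For an integer matrix $E$ with $n$ columns, let $\mathcal G(E)$ denote its Graver basis: the set of all nonzero $v\in\ker(E)\cap\mathbb Z^n$ that cannot be written as $v=v'+v''$ with nonzero $v',v''\in\ker(E)\cap\mathbb Z^n$ lying in a common orthant with $v$. The set $\mathcal G(E)$ is finite; put $\gamma(E):=\max\{\|v\|_1 : v\in\mathcal G(E)\}$, with $\gamma(E):=0$ if $\mathcal G(E)=\emptyset$. Let $A\in\mathbb Z^{d_A\times n_A}$, $B\in\mathbb Z^{d_A\times n_B}$, $C\in\mathbb Z^{d_C\times n_B}$, $D\in\mathbb Z^{d_C\times n_A}$, and for $N\in\mathbb Z_{\ge 0}$ let $$E_N:=\begin{pmatrix} C & D & D & \cdots & D\\ B & A & 0 & \cdots & 0\\ B & 0 & A & & 0\\ \vdots & \vdots & & \ddots & \\ B & 0 & 0 & & A\end{pmatrix},\qquad L_N:=\begin{pmatrix} B & A & 0 & \cdots & 0\\ B & 0 & A & & 0\\ \vdots & \vdots & & \ddots & \\ B & 0 & 0 & & A\end{pmatrix}$$ with $N$ copies of $A$ (so $L_N$ is $E_N$ without its first block row). There is a number $g\in\mathbb Z_{\ge 0}$,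 depending only on $A$ and $B$ and not on $N$, such that $\|v\|_\infty\le g$ for every $N\in\mathbb Z_{\ge 0}$ and every $v\in\mathcal G(L_N)$. For every such $g$, every real $M\ge 1$ that bounds the absolute values of all entries of $C$ and $D$, and every $N\in\mathbb Z_{\ge 0}$, $$\gamma(E_N)\;\le\;\bigl(2(n_B+Nn_A)M\bigr)^{2^{d_C}-1}\,\gamma(L_N)^{2^{d_C}}\;\le\;\bigl(2(n_B+Nn_A)M\bigr)^{2^{d_C}-1}\bigl((n_B+Nn_A)g\bigr)^{2^{d_C}}.$$ Moreover, for fixed $A,B,C,D$, one has $\gamma(E_N)=O\bigl(N^{2^{d_C}+1}\bigr)$ as $N\to\infty$; in particular $\gamma(E_N)$ is bounded by a polynomial in $N$. -/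

import Mathlib

open Matrix

/-- The Graver basis of an integer matrix `E`: the nonzero integer vectors `v` in the kernel of `E`
that are not a sum `v = u + w` of nonzero integer kernel vectors `u`, `w` lying in the same orthant
as `v`. A common orthant containing `u`, `w` (and hence also `u + w`) exists if and only if
`0 ≤ u i * w i` for every coordinate `i`. -/
def graverBasis {m n : Type*} [Fintype n] (E : Matrix m n ℤ) : Set (n → ℤ) :=
  {v | v ≠ 0 ∧ E *ᵥ v = 0 ∧
    ¬ ∃ u w : n → ℤ, u ≠ 0 ∧ w ≠ 0 ∧ E *ᵥ u = 0 ∧ E *ᵥ w = 0 ∧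
      (∀ i, 0 ≤ u i * w i) ∧ v = u + w}

/-- The `ℓ₁`-norm of an integer vector. -/
def l1Norm {n : Type*} [Fintype n] (v : n → ℤ) : ℕ := ∑ i, (v i).natAbs

/-- The maximum `ℓ₁`-norm of an element of the Graver basis of `E` (`0` if the basis is empty).
The supremum is a maximum whenever the Graver basis is finite and nonempty. -/
noncomputable def maxGraverNorm {m n : Type*} [Fintype n] (E : Matrix m n ℤ) : ℕ :=
  sSup (l1Norm '' graverBasis E)

/-- The two-stage matrix with `N` block rows `(B 0 ⋯ A ⋯ 0)`, i.e. the four-block matrix without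
the upper block row. Row `(i, k)` is row `i` of the `k`-th block row; column `Sum.inr (j, k)` is
column `j` of the `k`-th copy of `A`. -/
def twoStage {dA nA nB : ℕ} (N : ℕ) (B : Matrix (Fin dA) (Fin nB) ℤ)
    (A : Matrix (Fin dA) (Fin nA) ℤ) :
    Matrix (Fin dA × Fin N) (Fin nB ⊕ Fin nA × Fin N) ℤ :=
  fromCols (of fun p j => B p.1 j) (blockDiagonal fun _ : Fin N => A)

/-- The `N`-fold four-block matrix: upper block row `(C D ⋯ D)`, below it the two-stage matrix. -/
def fourBlock {dA nA nB dC : ℕ} (N : ℕ) (C : Matrix (Fin dC) (Fin nB) ℤ)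
    (D : Matrix (Fin dC) (Fin nA) ℤ) (B : Matrix (Fin dA) (Fin nB) ℤ)
    (A : Matrix (Fin dA) (Fin nA) ℤ) :
    Matrix (Fin dC ⊕ Fin dA × Fin N) (Fin nB ⊕ Fin nA × Fin N) ℤ :=
  fromRows (fromCols C (of fun i q => D i q.1)) (twoStage N B A)

/-- `g` bounds, for every `N`, the absolute values of all components of all Graver basis elements
of the `N`-fold two-stage matrix built from `A` and `B`. -/
def IsTwoStageGraverBound {dA nA nB : ℕ} (A : Matrix (Fin dA) (Fin nA) ℤ)
    (B : Matrix (Fin dA) (Fin nB) ℤ) (g : ℕ) : Prop :=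
  ∀ N : ℕ, ∀ v ∈ graverBasis (twoStage N B A), ∀ i, |v i| ≤ (g : ℤ)

/-!
Every kernel vector of `E` is a sum of Graver basis elements of `E` lying in its orthant. Adjoin a
row `a` with entries at most `K` to `E`. If a Graver basis element of the enlarged matrix is such a
sum `∑ G i`, then no proper nonempty subfamily of the integers `a ⬝ᵥ G i` sums to zero. These
integers are at most `K * maxGraverNorm E`, so ordering them with partial sums in a half-open
interval around `0` shows that there are at most `2 * K * maxGraverNorm E` of them. Hence a row
squares the maximal norm up to the factor `2 * K`, and `d` rows lead to the exponent `2 ^ d`. As `a`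
is paired with a vector of bounded `ℓ₁`-norm, the number of columns does not enter.

For two-stage matrices, record a Graver basis element by its first-stage part and the finite set of
its blocks. When a nonzero first-stage part lies conformally below another one and every block of
the second element dominates a block of the first, minimality of the second forces them to agree.
The order on finite sets used here is a well-quasi-order: the vectors dominating no member of a
finite set form a finite union of boxes, and Higman's lemma applies to lists of boxes. So only
finitely many records occur, whatever the number of blocks.
-/

/-! ### Well-quasi-orders on finite sets -/

theorem wellQuasiOrdered_finset_forall_exists_rel {α : Type*} {r : α → α → Prop} [IsPreorder α r]
    (hr : WellQuasiOrdered r) :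
    WellQuasiOrdered fun s t : Finset α => ∀ a ∈ s, ∃ b ∈ t, r a b := by
  intro f
  have higman := Set.PartiallyWellOrderedOn.partiallyWellOrderedOn_sublistForall₂ r
    (Set.partiallyWellOrderedOn_of_wellQuasiOrdered hr Set.univ)
  obtain ⟨i, j, hij, h⟩ := higman.exists_lt (f := fun k => (f k).toList)
    fun _ _ _ => Set.mem_univ _
  obtain ⟨l, hl, hsub⟩ := List.sublistForall₂_iff.1 h
  refine ⟨i, j, hij, fun a ha => ?_⟩
  obtain ⟨k, hk, rfl⟩ := List.getElem_of_mem (Finset.mem_toList.2 ha)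
  exact ⟨l[k]'(hl.length_eq ▸ hk), Finset.mem_toList.1 (hsub.subset (List.getElem_mem _)),
    hl.get hk _⟩

section AvoidanceBoxes

variable {ι α : Type*} [LinearOrder α]

open Classical in
/-- The boxes obtained by choosing, for every member `x` of the finite set `s`, a coordinate `σ x`
in which to stay strictly below `x`. A box is encoded by the tuple of its exclusive upper bounds,
where `⊤` stands for an unconstrained coordinate. -/
noncomputable def avoidanceBoxes [Fintype ι] (s : Finset (ι → α)) : Finset (ι → WithTop α) :=
  Finset.univ.image fun (σ : s → ι) i =>
    ({x | σ x = i} : Finset s).inf fun x => (x.1 i : WithTop α)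

theorem exists_mem_avoidanceBoxes_iff [Fintype ι] {s : Finset (ι → α)} {y : ι → α} :
    (∃ b ∈ avoidanceBoxes s, ∀ i, (y i : WithTop α) < b i) ↔ ∀ x ∈ s, ¬ x ≤ y := by
  classical
  have lt_box_iff (σ : s → ι) (i : ι) :
      (y i : WithTop α) < ({x | σ x = i} : Finset s).inf (fun x => (x.1 i : WithTop α)) ↔
        ∀ x, σ x = i → y i < x.1 i := by
    simp only [Finset.lt_inf_iff (WithTop.coe_lt_top (y i)), Finset.mem_filter, Finset.mem_univ,
      true_and, WithTop.coe_lt_coe]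
  simp only [avoidanceBoxes, Finset.mem_image, Finset.mem_univ, true_and, exists_exists_eq_and,
    lt_box_iff, Pi.le_def, not_forall, not_le]
  constructor
  · rintro ⟨σ, hσ⟩ x hx
    exact ⟨σ ⟨x, hx⟩, hσ _ ⟨x, hx⟩ rfl⟩
  · intro h
    choose σ hσ using h
    refine ⟨fun x => σ x x.2, ?_⟩
    rintro _ x rfl
    exact hσ x x.2

theorem wellQuasiOrdered_finset_forall_exists_le [Finite ι] [WellFoundedLT α] :
    WellQuasiOrdered fun s t : Finset (ι → α) => ∀ y ∈ t, ∃ x ∈ s, x ≤ y := by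
  have := Fintype.ofFinite ι
  intro f
  obtain ⟨i, j, hij, h⟩ := wellQuasiOrdered_finset_forall_exists_rel
    (wellQuasiOrdered_le (α := ι → WithTop α)) fun k => avoidanceBoxes (f k)
  refine ⟨i, j, hij, fun y hy => ?_⟩
  by_contra! hlow
  obtain ⟨b, hb, hyb⟩ := exists_mem_avoidanceBoxes_iff.2 hlow
  obtain ⟨c, hc, hbc⟩ := h b hb
  exact exists_mem_avoidanceBoxes_iff.1 ⟨c, hc, fun i => (hyb i).trans_le (hbc i)⟩ y hy le_rfl

end AvoidanceBoxes

/-! ### The conformal order -/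

/-- The conformal order on integer vectors: every coordinate of `u` lies between `0` and the
corresponding coordinate of `v`, so that `u` and `v` share an orthant. -/
def ConformalLE {n : Type*} (u v : n → ℤ) : Prop :=
  ∀ i, 0 ≤ u i ∧ u i ≤ v i ∨ v i ≤ u i ∧ u i ≤ 0

section Conformal

variable {n : Type*} {u v w : n → ℤ}

theorem ConformalLE.refl (u : n → ℤ) : ConformalLE u u := fun i => by
  omega

theorem ConformalLE.trans (huv : ConformalLE u v) (hvw : ConformalLE v w) : ConformalLE u w :=
  fun i => by
    have := huv i
    have := hvw i
    omega

instance : IsPreorder (n → ℤ) ConformalLE where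
  refl := .refl
  trans _ _ _ := .trans

theorem conformalLE_zero_left (v : n → ℤ) : ConformalLE 0 v := fun i => by
  simp only [Pi.zero_apply]
  omega

theorem ConformalLE.eq_zero (h : ConformalLE u 0) : u = 0 := by
  ext i
  have := h i
  simp only [Pi.zero_apply] at this ⊢
  omega

theorem conformalLE_add_right_iff : ConformalLE u (u + w) ↔ ∀ i, 0 ≤ u i * w i := by
  refine forall_congr' fun i => ?_
  rw [mul_nonneg_iff, Pi.add_apply]
  omega

theorem ConformalLE.sum_of_subset {ι : Type*} {G : ι → n → ℤ} {s t : Finset ι}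
    (hG : ∀ k ∈ t, ConformalLE (G k) v) (hst : s ⊆ t) :
    ConformalLE (∑ k ∈ s, G k) (∑ k ∈ t, G k) := by
  intro i
  simp only [Finset.sum_apply]
  rcases le_total 0 (v i) with hv | hv
  · have nonneg : ∀ k ∈ t, 0 ≤ G k i := fun k hk => by
      have := hG k hk i
      omega
    exact .inl ⟨Finset.sum_nonneg fun k hk => nonneg k (hst hk),
      Finset.sum_le_sum_of_subset_of_nonneg hst fun k hk _ => nonneg k hk⟩
  · have nonpos : ∀ k ∈ t, G k i ≤ 0 := fun k hk => by
      have := hG k hk i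
      omega
    exact .inr ⟨Finset.sum_le_sum_of_subset_of_nonpos' hst fun k hk _ => nonpos k hk,
      Finset.sum_nonpos fun k hk => nonpos k (hst hk)⟩

theorem ConformalLE.eq_empty_of_sum_eq_zero {ι : Type*} {G : ι → n → ℤ} {s : Finset ι}
    (hG : ∀ k ∈ s, ConformalLE (G k) v) (hG0 : ∀ k ∈ s, G k ≠ 0) (hsum : ∑ k ∈ s, G k = 0) :
    s = ∅ := by
  refine Finset.eq_empty_of_forall_notMem fun k hk => hG0 k hk (ConformalLE.eq_zero ?_)
  simpa [hsum] using ConformalLE.sum_of_subset hG (Finset.singleton_subset_iff.2 hk)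

/-- The positive parts and the negative parts of the coordinates of `v`. This turns the conformal
order into the coordinatewise order on vectors of natural numbers. -/
def signParts (v : n → ℤ) : n ⊕ n → ℕ :=
  Sum.elim (fun i => (v i).toNat) fun i => (-v i).toNat

theorem signParts_le_signParts_iff : signParts u ≤ signParts v ↔ ConformalLE u v := by
  simp only [signParts, Pi.le_def, Sum.forall, Sum.elim_inl, Sum.elim_inr, ← forall_and]
  exact forall_congr' fun i => by omega

theorem wellQuasiOrdered_conformalLE [Finite n] :
    WellQuasiOrdered (ConformalLE : (n → ℤ) → (n → ℤ) → Prop) := by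
  intro f
  obtain ⟨i, j, hij, h⟩ := wellQuasiOrdered_le fun k => signParts (f k)
  exact ⟨i, j, hij, signParts_le_signParts_iff.1 h⟩

theorem wellQuasiOrdered_finset_forall_exists_conformalLE [Finite n] :
    WellQuasiOrdered fun s t : Finset (n → ℤ) => ∀ w ∈ t, ∃ u ∈ s, ConformalLE u w := by
  classical
  intro f
  obtain ⟨i, j, hij, h⟩ := wellQuasiOrdered_finset_forall_exists_le
    fun k => (f k).image signParts
  refine ⟨i, j, hij, ?_⟩
  simpa only [Finset.forall_mem_image, Finset.exists_mem_image, signParts_le_signParts_iff] using h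

end Conformal

/-! ### The `ℓ₁`-norm -/

section L1Norm

variable {n : Type*} [Fintype n]

theorem l1Norm_pos {v : n → ℤ} (hv : v ≠ 0) : 0 < l1Norm v := by
  obtain ⟨i, hi⟩ := Function.ne_iff.1 hv
  exact Finset.sum_pos' (fun _ _ => Nat.zero_le _) ⟨i, Finset.mem_univ _, Int.natAbs_pos.2 hi⟩

theorem l1Norm_add_of_mul_nonneg {u w : n → ℤ} (h : ∀ i, 0 ≤ u i * w i) :
    l1Norm (u + w) = l1Norm u + l1Norm w := by
  rw [l1Norm, l1Norm, l1Norm, ← Finset.sum_add_distrib]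
  refine Finset.sum_congr rfl fun i _ => ?_
  have := mul_nonneg_iff.1 (h i)
  rw [Pi.add_apply]
  omega

theorem l1Norm_sum_le {ι : Type*} (s : Finset ι) (G : ι → n → ℤ) :
    l1Norm (∑ k ∈ s, G k) ≤ ∑ k ∈ s, l1Norm (G k) := by
  simp only [l1Norm, Finset.sum_apply]
  rw [Finset.sum_comm]
  exact Finset.sum_le_sum fun i _ => Int.natAbs_sum_le s fun k => G k i

theorem abs_dotProduct_le_mul_l1Norm {a : n → ℤ} {K : ℕ} (ha : ∀ j, |a j| ≤ K) (v : n → ℤ) :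
    |a ⬝ᵥ v| ≤ K * l1Norm v := by
  simp only [dotProduct, l1Norm, Nat.cast_sum, Finset.mul_sum, Int.natCast_natAbs]
  refine (Finset.abs_sum_le_sum_abs _ _).trans (Finset.sum_le_sum fun i _ => ?_)
  rw [abs_mul]
  exact mul_le_mul_of_nonneg_right (ha i) (abs_nonneg _)

end L1Norm

/-! ### Graver bases -/

section Graver

variable {m n : Type*} [Fintype n] {E : Matrix m n ℤ}

theorem mem_graverBasis_iff {v : n → ℤ} :
    v ∈ graverBasis E ↔
      v ≠ 0 ∧ E *ᵥ v = 0 ∧ ∀ u, u ≠ 0 → E *ᵥ u = 0 → ConformalLE u v → u = v := by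
  refine and_congr_right fun hv => and_congr_right fun hE => ⟨fun h u hu hEu huv => ?_, ?_⟩
  · by_contra hne
    exact h ⟨u, v - u, hu, sub_ne_zero.2 (Ne.symm hne), hEu, by rw [mulVec_sub, hE, hEu, sub_zero],
      conformalLE_add_right_iff.1 (by rwa [add_sub_cancel]), (add_sub_cancel u v).symm⟩
  · rintro h ⟨u, w, hu, hw, hEu, -, huw, rfl⟩
    exact hw (left_eq_add.1 (h u hu hEu (conformalLE_add_right_iff.2 huw)))

theorem eq_of_conformalLE_of_mem_graverBasis {u v : n → ℤ} (hv : v ∈ graverBasis E) (hu : u ≠ 0)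
    (hEu : E *ᵥ u = 0) (huv : ConformalLE u v) : u = v :=
  (mem_graverBasis_iff.1 hv).2.2 u hu hEu huv

theorem finite_graverBasis (E : Matrix m n ℤ) : (graverBasis E).Finite :=
  have antichain : IsAntichain ConformalLE (graverBasis E) := fun _ hu _ hv hne huv =>
    hne (eq_of_conformalLE_of_mem_graverBasis hv hu.1 hu.2.1 huv)
  antichain.finite_of_wellQuasiOrdered wellQuasiOrdered_conformalLE

theorem l1Norm_le_maxGraverNorm {v : n → ℤ} (hv : v ∈ graverBasis E) :
    l1Norm v ≤ maxGraverNorm E :=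
  le_csSup ((finite_graverBasis E).image _).bddAbove ⟨v, hv, rfl⟩

theorem maxGraverNorm_le {b : ℕ} (h : ∀ v ∈ graverBasis E, l1Norm v ≤ b) : maxGraverNorm E ≤ b :=
  csSup_le' (Set.forall_mem_image.2 h)

theorem maxGraverNorm_congr {m' : Type*} {E' : Matrix m' n ℤ}
    (h : ∀ v, E *ᵥ v = 0 ↔ E' *ᵥ v = 0) : maxGraverNorm E = maxGraverNorm E' := by
  simp only [maxGraverNorm, graverBasis, h]

theorem exists_graverBasis_sum_eq (v : n → ℤ) (hE : E *ᵥ v = 0) :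
    ∃ (k : ℕ) (G : Fin k → n → ℤ),
      (∀ i, G i ∈ graverBasis E ∧ ConformalLE (G i) v) ∧ ∑ i, G i = v := by
  induction hb : l1Norm v using Nat.strong_induction_on generalizing v with | _ b ih =>
  by_cases hv0 : v = 0
  · exact ⟨0, Fin.elim0, fun i => i.elim0, by simp [hv0]⟩
  by_cases hv : v ∈ graverBasis E
  · exact ⟨1, fun _ => v, fun _ => ⟨hv, .refl v⟩, by simp⟩
  obtain ⟨u, w, hu, hw, hEu, hEw, huw, hvuw⟩ :
      ∃ u w : n → ℤ, u ≠ 0 ∧ w ≠ 0 ∧ E *ᵥ u = 0 ∧ E *ᵥ w = 0 ∧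
        (∀ i, 0 ≤ u i * w i) ∧ v = u + w := by
    by_contra hindec
    exact hv ⟨hv0, hE, hindec⟩
  have huv : ConformalLE u v := hvuw ▸ conformalLE_add_right_iff.2 huw
  have hwv : ConformalLE w v := by
    rw [hvuw, add_comm]
    exact conformalLE_add_right_iff.2 fun i => mul_comm (u i) (w i) ▸ huw i
  have hnorm : b = l1Norm u + l1Norm w := by rw [← hb, hvuw, l1Norm_add_of_mul_nonneg huw]
  have hub : l1Norm u < b := hnorm ▸ Nat.lt_add_of_pos_right (l1Norm_pos hw)
  have hwb : l1Norm w < b := hnorm ▸ Nat.lt_add_of_pos_left (l1Norm_pos hu)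
  obtain ⟨k, G, hG, hGu⟩ := ih _ hub u hEu rfl
  obtain ⟨l, H, hH, hHw⟩ := ih _ hwb w hEw rfl
  refine ⟨k + l, Fin.append G H, fun i => ?_, ?_⟩
  · cases i using Fin.addCases with
    | left i => exact Fin.append_left G H i ▸ ⟨(hG i).1, (hG i).2.trans huv⟩
    | right i => exact Fin.append_right G H i ▸ ⟨(hH i).1, (hH i).2.trans hwv⟩
  · simp [Fin.sum_univ_add, hGu, hHw, hvuw]

end Graver

/-! ### Zero-sum subfamilies of bounded integers -/

section ZeroSum

variable {ι : Type*} [Fintype ι] {f : ι → ℤ} {b : ℕ}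

theorem exists_insert_sum_mem_Ioc [DecidableEq ι] (hf : ∀ i, |f i| ≤ b) (hsum : ∑ i, f i = 0)
    {s : Finset ι} (hs : s ≠ Finset.univ) (hsb : ∑ i ∈ s, f i ∈ Finset.Ioc (-b : ℤ) b) :
    ∃ i ∉ s, ∑ j ∈ insert i s, f j ∈ Finset.Ioc (-b : ℤ) b := by
  have hcompl : ∑ i ∈ sᶜ, f i = -∑ i ∈ s, f i := by
    have := Finset.sum_add_sum_compl s f
    omega
  have hne : sᶜ.Nonempty := by rwa [Finset.nonempty_iff_ne_empty, Ne, Finset.compl_eq_empty_iff]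
  obtain ⟨i, hi, hsign⟩ : ∃ i ∈ sᶜ,
      (∑ j ∈ s, f j ≤ 0 ∧ 0 ≤ f i) ∨ (0 < ∑ j ∈ s, f j ∧ f i < 0) := by
    by_contra! hcon
    rcases le_or_gt (∑ j ∈ s, f j) 0 with h | h
    · have := Finset.sum_lt_sum_of_nonempty hne fun i hi => (hcon i hi).1 h
      rw [Finset.sum_const_zero] at this
      omega
    · have := Finset.sum_nonneg fun i hi => (hcon i hi).2 h
      omega
  rw [Finset.mem_compl] at hi
  refine ⟨i, hi, ?_⟩
  have := abs_le.1 (hf i)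
  simp only [Finset.sum_insert hi, Finset.mem_Ioc] at hsb ⊢
  omega

theorem exists_monotone_sum_mem_Ioc (hb : 0 < b) (hf : ∀ i, |f i| ≤ b) (hsum : ∑ i, f i = 0) :
    ∃ s : ℕ → Finset ι, Monotone s ∧ (∀ k ≤ Fintype.card ι, (s k).card = k) ∧
      ∀ k, ∑ i ∈ s k, f i ∈ Finset.Ioc (-b : ℤ) b := by
  classical
  have hnext : ∀ s : {s : Finset ι // ∑ i ∈ s, f i ∈ Finset.Ioc (-b : ℤ) b},
      ∃ t : {t : Finset ι // ∑ i ∈ t, f i ∈ Finset.Ioc (-b : ℤ) b},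
        s.1 ⊆ t.1 ∧ (s.1 ≠ Finset.univ → t.1.card = s.1.card + 1) := by
    rintro ⟨s, hsb⟩
    by_cases hs : s = Finset.univ
    · exact ⟨⟨s, hsb⟩, subset_rfl, fun h => absurd hs h⟩
    · obtain ⟨i, hi, hib⟩ := exists_insert_sum_mem_Ioc hf hsum hs hsb
      exact ⟨⟨insert i s, hib⟩, Finset.subset_insert i s, fun _ => Finset.card_insert_of_notMem hi⟩
  choose next hsub hcard using hnext
  let s (k : ℕ) := next^[k] ⟨∅, by simp [hb]⟩
  have hsucc (k : ℕ) : s (k + 1) = next (s k) := Function.iterate_succ_apply' next k _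
  have hscard : ∀ k ≤ Fintype.card ι, (s k).1.card = k := fun k hk => by
    induction k with
    | zero => rfl
    | succ k ih =>
      have hproper : (s k).1 ≠ Finset.univ := fun h => by
        have := ih (by omega)
        rw [h, Finset.card_univ] at this
        omega
      rw [hsucc, hcard _ hproper, ih (by omega)]
  exact ⟨fun k => (s k).1, monotone_nat_of_le_succ fun k => hsucc k ▸ hsub (s k), hscard,
    fun k => (s k).2⟩

theorem exists_proper_subset_sum_eq_zero (hb : 0 < b) (hf : ∀ i, |f i| ≤ b)
    (hsum : ∑ i, f i = 0) (hcard : 2 * b < Fintype.card ι) :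
    ∃ s : Finset ι, s ≠ ∅ ∧ s ≠ Finset.univ ∧ ∑ i ∈ s, f i = 0 := by
  classical
  obtain ⟨s, hmono, hscard, hsb⟩ := exists_monotone_sum_mem_Ioc hb hf hsum
  obtain ⟨k, hk, l, hl, hkl, heq⟩ := Finset.exists_ne_map_eq_of_card_lt_of_maps_to
    (s := Finset.range (Fintype.card ι)) (t := Finset.Ioc (-b : ℤ) b)
    (f := fun k => ∑ i ∈ s k, f i) (by rw [Int.card_Ioc, Finset.card_range]; omega)
    fun k _ => hsb k
  wlog hlt : k < l generalizing k l
  · exact this l hl k hk hkl.symm heq.symm (by omega)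
  rw [Finset.mem_range] at hk hl
  have hsdiff : (s l \ s k).card = l - k := by
    rw [Finset.card_sdiff_of_subset (hmono hlt.le), hscard l hl.le, hscard k hk.le]
  refine ⟨s l \ s k, fun h => ?_, fun h => ?_, ?_⟩
  · rw [h, Finset.card_empty] at hsdiff
    omega
  · rw [h, Finset.card_univ] at hsdiff
    omega
  · have := Finset.sum_sdiff (f := f) (hmono hlt.le)
    omega

end ZeroSum

/-! ### Adjoining rows -/

section FromRows

variable {m n : Type*} [Fintype n]

theorem fromRows_mulVec_eq_zero_iff {r : Type*} (R : Matrix r n ℤ) (E : Matrix m n ℤ) (v : n → ℤ) :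
    fromRows R E *ᵥ v = 0 ↔ R *ᵥ v = 0 ∧ E *ᵥ v = 0 := by
  simp only [fromRows_mulVec, funext_iff, Sum.forall, Sum.elim_inl, Sum.elim_inr, Pi.zero_apply]

theorem fromRows_replicateRow_mulVec_eq_zero_iff (a : n → ℤ) (E : Matrix m n ℤ) (v : n → ℤ) :
    fromRows (replicateRow Unit a) E *ᵥ v = 0 ↔ a ⬝ᵥ v = 0 ∧ E *ᵥ v = 0 := by
  rw [fromRows_mulVec_eq_zero_iff, replicateRow_mulVec_eq_const]
  simp only [funext_iff, Function.const_apply, Pi.zero_apply, forall_const]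

theorem card_le_of_sum_mem_graverBasis_fromRows {ι : Type*} [Fintype ι] {a : n → ℤ}
    {E : Matrix m n ℤ} {G : ι → n → ℤ} {b : ℕ} (hb : 0 < b)
    (hsum : ∑ i, G i ∈ graverBasis (fromRows (replicateRow Unit a) E)) (hG0 : ∀ i, G i ≠ 0)
    (hGE : ∀ i, E *ᵥ G i = 0) (hconf : ∀ i, ConformalLE (G i) (∑ i, G i))
    (hab : ∀ i, |a ⬝ᵥ G i| ≤ b) : Fintype.card ι ≤ 2 * b := by
  classical
  by_contra! hcard
  have htotal : ∑ i, a ⬝ᵥ G i = 0 := by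
    rw [← dotProduct_sum]
    exact ((fromRows_replicateRow_mulVec_eq_zero_iff a E _).1 hsum.2.1).1
  obtain ⟨s, hs_empty, hs_univ, hs⟩ := exists_proper_subset_sum_eq_zero hb hab htotal hcard
  have hker : fromRows (replicateRow Unit a) E *ᵥ ∑ i ∈ s, G i = 0 := by
    rw [fromRows_replicateRow_mulVec_eq_zero_iff, dotProduct_sum, mulVec_sum]
    exact ⟨hs, Finset.sum_eq_zero fun i _ => hGE i⟩
  have hs0 : ∑ i ∈ s, G i ≠ 0 := fun h => hs_empty
    (ConformalLE.eq_empty_of_sum_eq_zero (fun i _ => hconf i) (fun i _ => hG0 i) h)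
  have hall : ∑ i ∈ s, G i = ∑ i, G i := eq_of_conformalLE_of_mem_graverBasis hsum hs0 hker
    (ConformalLE.sum_of_subset (fun i _ => hconf i) (Finset.subset_univ s))
  have hcompl : ∑ i ∈ sᶜ, G i = 0 := by
    rwa [← Finset.sum_add_sum_compl s G, left_eq_add] at hall
  exact hs_univ ((Finset.compl_eq_empty_iff s).1
    (ConformalLE.eq_empty_of_sum_eq_zero (fun i _ => hconf i) (fun i _ => hG0 i) hcompl))

theorem maxGraverNorm_fromRows_replicateRow_le {a : n → ℤ} {K : ℕ} (hK : 1 ≤ K)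
    (ha : ∀ j, |a j| ≤ K) (E : Matrix m n ℤ) :
    maxGraverNorm (fromRows (replicateRow Unit a) E) ≤ 2 * K * maxGraverNorm E ^ 2 := by
  refine maxGraverNorm_le fun v hv => ?_
  obtain ⟨k, G, hG, rfl⟩ := exists_graverBasis_sum_eq v
    ((fromRows_replicateRow_mulVec_eq_zero_iff a E v).1 hv.2.1).2
  have hnorm (i : Fin k) : l1Norm (G i) ≤ maxGraverNorm E := l1Norm_le_maxGraverNorm (hG i).1
  have hpos : 0 < maxGraverNorm E := by
    obtain ⟨i, -, hi⟩ := Finset.exists_ne_zero_of_sum_ne_zero hv.1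
    exact (l1Norm_pos hi).trans_le (hnorm i)
  have hdot (i : Fin k) : |a ⬝ᵥ G i| ≤ (K * maxGraverNorm E : ℕ) :=
    (abs_dotProduct_le_mul_l1Norm ha (G i)).trans
      (by exact_mod_cast Nat.mul_le_mul_left K (hnorm i))
  have hk : k ≤ 2 * (K * maxGraverNorm E) := by
    simpa using card_le_of_sum_mem_graverBasis_fromRows (Nat.mul_pos hK hpos) hv
      (fun i => (hG i).1.1) (fun i => (hG i).1.2.1) (fun i => (hG i).2) hdot
  calc l1Norm (∑ i, G i) ≤ ∑ i, l1Norm (G i) := l1Norm_sum_le _ G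
    _ ≤ k * maxGraverNorm E := by
      simpa using Finset.sum_le_card_nsmul Finset.univ _ _ fun i _ => hnorm i
    _ ≤ 2 * (K * maxGraverNorm E) * maxGraverNorm E := Nat.mul_le_mul_right _ hk
    _ = 2 * K * maxGraverNorm E ^ 2 := by ring

theorem maxGraverNorm_fromRows_le {r : Type*} [Finite r] {R : Matrix r n ℤ} {K : ℕ} (hK : 1 ≤ K)
    (hR : ∀ i j, |R i j| ≤ K) (E : Matrix m n ℤ) :
    maxGraverNorm (fromRows R E) ≤
      (2 * K) ^ (2 ^ Nat.card r - 1) * maxGraverNorm E ^ (2 ^ Nat.card r) := by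
  induction r using Finite.induction_empty_option with
  | @of_equiv r r' e ih =>
    rw [← Nat.card_congr e, maxGraverNorm_congr (E' := fromRows (R.submatrix e id) E) fun v => ?_]
    · exact ih fun i => hR (e i)
    · rw [fromRows_mulVec_eq_zero_iff, fromRows_mulVec_eq_zero_iff]
      refine and_congr_left fun _ => ?_
      rw [funext_iff, funext_iff, ← e.forall_congr_right]
      rfl
  | h_empty =>
    rw [maxGraverNorm_congr (E' := E) fun v => by
      rw [fromRows_mulVec_eq_zero_iff, and_iff_right (Subsingleton.elim _ _)]]
    simp
  | @h_option r _ ih =>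
    have hker (v : n → ℤ) : fromRows R E *ᵥ v = 0 ↔
        fromRows (replicateRow Unit (R none)) (fromRows (R.submatrix some id) E) *ᵥ v = 0 := by
      rw [fromRows_replicateRow_mulVec_eq_zero_iff, fromRows_mulVec_eq_zero_iff,
        fromRows_mulVec_eq_zero_iff, ← and_assoc]
      refine and_congr_left fun _ => ?_
      rw [funext_iff, Option.forall, funext_iff]
      rfl
    have hexp : 2 ^ (Nat.card r + 1) - 1 = 1 + (2 ^ Nat.card r - 1) * 2 := by
      have := Nat.one_le_two_pow (n := Nat.card r)
      omega
    calc maxGraverNorm (fromRows R E)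
        = maxGraverNorm
            (fromRows (replicateRow Unit (R none)) (fromRows (R.submatrix some id) E)) :=
          maxGraverNorm_congr hker
      _ ≤ 2 * K * maxGraverNorm (fromRows (R.submatrix some id) E) ^ 2 :=
          maxGraverNorm_fromRows_replicateRow_le hK (hR none) _
      _ ≤ 2 * K * ((2 * K) ^ (2 ^ Nat.card r - 1) * maxGraverNorm E ^ (2 ^ Nat.card r)) ^ 2 := by
          gcongr
          exact ih fun i => hR (some i)
      _ = (2 * K) ^ (2 ^ Nat.card (Option r) - 1) *
            maxGraverNorm E ^ (2 ^ Nat.card (Option r)) := by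
          rw [Finite.card_option, hexp]
          ring

end FromRows

/-! ### Two-stage matrices -/

/-- The vector with first-stage part `x` and second-stage blocks `y k`, its coordinates indexed
like the columns of `twoStage`. -/
def stageVector {α β κ : Type*} (x : α → ℤ) (y : κ → β → ℤ) : α ⊕ β × κ → ℤ :=
  Sum.elim x fun p => y p.2 p.1

section StageVector

variable {α β κ : Type*} {x x' : α → ℤ} {y y' : κ → β → ℤ}

theorem exists_stageVector_eq (v : α ⊕ β × κ → ℤ) :
    ∃ (x : α → ℤ) (y : κ → β → ℤ), stageVector x y = v :=
  ⟨fun i => v (.inl i), fun k j => v (.inr (j, k)), by ext (i | p) <;> rfl⟩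

theorem stageVector_inj : stageVector x y = stageVector x' y' ↔ x = x' ∧ y = y' := by
  simp only [stageVector, funext_iff, Sum.forall, Sum.elim_inl, Sum.elim_inr, Prod.forall]
  rw [forall_comm (β := κ)]

theorem stageVector_zero : stageVector (0 : α → ℤ) (0 : κ → β → ℤ) = 0 := by
  ext (i | p) <;> rfl

theorem conformalLE_stageVector_iff :
    ConformalLE (stageVector x y) (stageVector x' y') ↔
      ConformalLE x x' ∧ ∀ k, ConformalLE (y k) (y' k) := by
  simp only [ConformalLE, stageVector, Sum.forall, Sum.elim_inl, Sum.elim_inr, Prod.forall]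
  rw [forall_comm (β := κ)]

end StageVector

section TwoStage

variable {dA nA nB N : ℕ} {A : Matrix (Fin dA) (Fin nA) ℤ} {B : Matrix (Fin dA) (Fin nB) ℤ}

theorem twoStage_mulVec_stageVector_eq_zero_iff {x : Fin nB → ℤ} {y : Fin N → Fin nA → ℤ} :
    twoStage N B A *ᵥ stageVector x y = 0 ↔ ∀ k, B *ᵥ x + A *ᵥ y k = 0 := by
  simp only [funext_iff, Prod.forall, twoStage, fromCols_mulVec, Pi.add_apply, Pi.zero_apply]
  rw [forall_comm]
  refine forall_congr' fun k => forall_congr' fun i => ?_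
  simp [mulVec, dotProduct, blockDiagonal_apply, Fintype.sum_prod_type, stageVector]

theorem eq_and_range_subset_of_mem_graverBasis_twoStage {N' : ℕ} {x x' : Fin nB → ℤ}
    {y : Fin N → Fin nA → ℤ} {y' : Fin N' → Fin nA → ℤ} (hx : x ≠ 0)
    (hxy : twoStage N B A *ᵥ stageVector x y = 0)
    (hxy' : stageVector x' y' ∈ graverBasis (twoStage N' B A)) (hxx' : ConformalLE x x')
    (hyy' : ∀ k', ∃ k, ConformalLE (y k) (y' k')) :
    x = x' ∧ Set.range y' ⊆ Set.range y := by
  choose σ hσ using hyy'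
  have heq : stageVector x (fun k' => y (σ k')) = stageVector x' y' := by
    refine eq_of_conformalLE_of_mem_graverBasis hxy' (fun h0 => hx ?_) ?_
      (conformalLE_stageVector_iff.2 ⟨hxx', hσ⟩)
    · exact (stageVector_inj.1 (h0.trans stageVector_zero.symm)).1
    · rw [twoStage_mulVec_stageVector_eq_zero_iff] at hxy ⊢
      exact fun k' => hxy (σ k')
  obtain ⟨rfl, rfl⟩ := stageVector_inj.1 heq
  exact ⟨rfl, Set.range_comp_subset_range σ y⟩

theorem block_mem_graverBasis_of_stageVector_zero_mem {y : Fin N → Fin nA → ℤ}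
    (hy : stageVector (0 : Fin nB → ℤ) y ∈ graverBasis (twoStage N B A)) {k : Fin N}
    (hk : y k ≠ 0) : y k ∈ graverBasis A := by
  have hAy := twoStage_mulVec_stageVector_eq_zero_iff.1 hy.2.1
  simp only [mulVec_zero, zero_add] at hAy
  refine mem_graverBasis_iff.2 ⟨hk, hAy k, fun u hu hAu huy => ?_⟩
  have heq : stageVector (0 : Fin nB → ℤ) (Pi.single k u) = stageVector 0 y := by
    refine eq_of_conformalLE_of_mem_graverBasis hy (fun h0 => hu ?_) ?_
      (conformalLE_stageVector_iff.2 ⟨.refl 0, fun l => ?_⟩)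
    · simpa using (stageVector_inj.1 (h0.trans stageVector_zero.symm)).2
    · rw [twoStage_mulVec_stageVector_eq_zero_iff]
      intro l
      rcases eq_or_ne l k with rfl | hl
      · simpa using hAu
      · simp [hl]
    · rcases eq_or_ne l k with rfl | hl
      · simpa using huy
      · simpa [hl] using conformalLE_zero_left (y l)
  simpa using congrFun (stageVector_inj.1 heq).2 k

/-- The pairs of first-stage part and set of second-stage blocks of the Graver basis elements with
nonzero first-stage part, over all two-stage matrices built from `A` and `B`. -/
def twoStageProfiles {dA nA nB : ℕ} (A : Matrix (Fin dA) (Fin nA) ℤ)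
    (B : Matrix (Fin dA) (Fin nB) ℤ) : Set ((Fin nB → ℤ) × Finset (Fin nA → ℤ)) :=
  {p | p.1 ≠ 0 ∧ ∃ (N : ℕ) (y : Fin N → Fin nA → ℤ),
    stageVector p.1 y ∈ graverBasis (twoStage N B A) ∧ Set.range y = p.2}

theorem finite_twoStageProfiles (A : Matrix (Fin dA) (Fin nA) ℤ) (B : Matrix (Fin dA) (Fin nB) ℤ) :
    (twoStageProfiles A B).Finite := by
  -- Comparing cardinalities too turns the inclusion `t ⊆ s` of comparable profiles into `s = t`.
  let r (p q : (Fin nB → ℤ) × Finset (Fin nA → ℤ)) : Prop :=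
    p.2.card ≤ q.2.card ∧ ConformalLE p.1 q.1 ∧ ∀ w ∈ q.2, ∃ u ∈ p.2, ConformalLE u w
  have hr : WellQuasiOrdered r := fun f =>
    (wellQuasiOrdered_le (α := ℕ)).prod
      (wellQuasiOrdered_conformalLE.prod wellQuasiOrdered_finset_forall_exists_conformalLE)
      fun k => ((f k).2.card, f k)
  refine IsAntichain.finite_of_wellQuasiOrdered (r := r) ?_ hr
  rintro ⟨x, s⟩ ⟨hx, N, y, hy, hs⟩ ⟨x', t⟩ ⟨-, N', y', hy', ht⟩ hne ⟨hcard, hxx', hst⟩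
  have hyy' : ∀ k', ∃ k, ConformalLE (y k) (y' k') := by
    simp only [← Finset.mem_coe, ← hs, ← ht, Set.forall_mem_range, Set.exists_range_iff] at hst
    exact hst
  obtain ⟨hx_eq, hsub⟩ :=
    eq_and_range_subset_of_mem_graverBasis_twoStage hx hy.2.1 hy' hxx' hyy'
  rw [hs, ht, Finset.coe_subset] at hsub
  exact hne (Prod.ext hx_eq (Finset.eq_of_subset_of_card_le hsub hcard).symm)

theorem exists_forall_abs_le_of_finite {n : Type*} [Finite n] {S : Set (n → ℤ)} (hS : S.Finite) :
    ∃ b : ℕ, ∀ v ∈ S, ∀ i, |v i| ≤ b := by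
  have := hS.to_subtype
  obtain ⟨b, hb⟩ := Finite.bddAbove_range fun p : S × n => (p.1.1 p.2).natAbs
  refine ⟨b, fun v hv i => ?_⟩
  rw [Int.abs_eq_natAbs]
  exact_mod_cast hb ⟨(⟨v, hv⟩, i), rfl⟩

theorem exists_isTwoStageGraverBound (A : Matrix (Fin dA) (Fin nA) ℤ)
    (B : Matrix (Fin dA) (Fin nB) ℤ) : ∃ g : ℕ, IsTwoStageGraverBound A B g := by
  have hprofiles := finite_twoStageProfiles A B
  obtain ⟨a, ha⟩ := exists_forall_abs_le_of_finite (hprofiles.image Prod.fst)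
  obtain ⟨b, hb⟩ := exists_forall_abs_le_of_finite
    (hprofiles.biUnion fun p _ => p.2.finite_toSet)
  obtain ⟨c, hc⟩ := exists_forall_abs_le_of_finite (finite_graverBasis A)
  refine ⟨a + b + c, fun N v hv => ?_⟩
  obtain ⟨x, y, rfl⟩ := exists_stageVector_eq v
  have hx (j : Fin nB) : |x j| ≤ a + b + c := by
    by_cases hx0 : x = 0
    · rw [hx0, Pi.zero_apply, abs_zero]
      omega
    · have := ha x ⟨(x, Finset.univ.image y), ⟨hx0, N, y, hv, by simp⟩, rfl⟩ j
      omega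
  have hy (k : Fin N) (j : Fin nA) : |y k j| ≤ a + b + c := by
    by_cases hx0 : x = 0
    · subst hx0
      by_cases hyk : y k = 0
      · rw [hyk, Pi.zero_apply, abs_zero]
        omega
      · have := hc (y k) (block_mem_graverBasis_of_stageVector_zero_mem hv hyk) j
        omega
    · have := hb (y k) (Set.mem_biUnion (x := (x, Finset.univ.image y))
        ⟨hx0, N, y, hv, by simp⟩ (by simp)) j
      omega
  rintro (j | ⟨j, k⟩)
  · exact_mod_cast hx j
  · exact_mod_cast hy k j

theorem maxGraverNorm_twoStage_le {g : ℕ} (hg : IsTwoStageGraverBound A B g) (N : ℕ) :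
    maxGraverNorm (twoStage N B A) ≤ (nB + N * nA) * g := by
  refine maxGraverNorm_le fun v hv => ?_
  have hentry (i : Fin nB ⊕ Fin nA × Fin N) : (v i).natAbs ≤ g := by
    have := hg N v hv i
    rw [Int.abs_eq_natAbs] at this
    exact_mod_cast this
  simpa [l1Norm, mul_comm nA N] using
    Finset.sum_le_card_nsmul Finset.univ (fun i => (v i).natAbs) g fun i _ => hentry i

theorem isBigO_maxGraverNorm_twoStage (A : Matrix (Fin dA) (Fin nA) ℤ)
    (B : Matrix (Fin dA) (Fin nB) ℤ) :
    (fun N : ℕ => (maxGraverNorm (twoStage N B A) : ℝ)) =O[Filter.atTop] fun N : ℕ => (N : ℝ) := by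
  obtain ⟨g, hg⟩ := exists_isTwoStageGraverBound A B
  refine Asymptotics.IsBigO.of_bound ((nB + nA) * g : ℕ) ?_
  filter_upwards [Filter.eventually_ge_atTop 1] with N hN
  rw [Real.norm_natCast, Real.norm_natCast]
  norm_cast
  calc maxGraverNorm (twoStage N B A) ≤ (nB + N * nA) * g := maxGraverNorm_twoStage_le hg N
    _ ≤ (N * nB + N * nA) * g := by
      gcongr
      exact Nat.le_mul_of_pos_left _ hN
    _ = (nB + nA) * g * N := by ring

end TwoStage

/-! ### Four-block matrices -/

section FourBlock

variable {dA nA nB dC : ℕ} {A : Matrix (Fin dA) (Fin nA) ℤ} {B : Matrix (Fin dA) (Fin nB) ℤ}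
  {C : Matrix (Fin dC) (Fin nB) ℤ} {D : Matrix (Fin dC) (Fin nA) ℤ} {M : ℝ}

theorem maxGraverNorm_fourBlock_le (hM : 1 ≤ M) (hC : ∀ i j, |(C i j : ℝ)| ≤ M)
    (hD : ∀ i j, |(D i j : ℝ)| ≤ M) (N : ℕ) :
    (maxGraverNorm (fourBlock N C D B A) : ℝ) ≤
      (2 * M) ^ (2 ^ dC - 1) * (maxGraverNorm (twoStage N B A) : ℝ) ^ (2 ^ dC) := by
  have hfloor (z : ℤ) (hz : |(z : ℝ)| ≤ M) : |z| ≤ (⌊M⌋₊ : ℤ) := by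
    rw [Int.abs_eq_natAbs, Nat.cast_le]
    exact Nat.le_floor (by rwa [Nat.cast_natAbs, Int.cast_abs])
  have hupper : ∀ i j,
      |fromCols C (of fun i (q : Fin nA × Fin N) => D i q.1) i j| ≤ (⌊M⌋₊ : ℤ) := by
    rintro i (j | q)
    · exact hfloor _ (hC i j)
    · exact hfloor _ (hD i q.1)
  have hnat : maxGraverNorm (fourBlock N C D B A) ≤
      (2 * ⌊M⌋₊) ^ (2 ^ dC - 1) * maxGraverNorm (twoStage N B A) ^ (2 ^ dC) := by
    simpa only [Nat.card_fin, fourBlock] using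
      maxGraverNorm_fromRows_le (Nat.one_le_floor_iff M |>.2 hM) hupper (twoStage N B A)
  calc (maxGraverNorm (fourBlock N C D B A) : ℝ)
      ≤ (2 * ⌊M⌋₊) ^ (2 ^ dC - 1) * (maxGraverNorm (twoStage N B A) : ℝ) ^ (2 ^ dC) := by
        exact_mod_cast hnat
    _ ≤ (2 * M) ^ (2 ^ dC - 1) * (maxGraverNorm (twoStage N B A) : ℝ) ^ (2 ^ dC) := by
        gcongr
        exact Nat.floor_le (zero_le_one.trans hM)

theorem exists_one_le_forall_abs_le {m n : Type*} [Finite m] [Finite n] (R : Matrix m n ℤ) :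
    ∃ M : ℝ, 1 ≤ M ∧ ∀ i j, |(R i j : ℝ)| ≤ M := by
  obtain ⟨M, hM⟩ := Finite.bddAbove_range fun p : m × n => |(R p.1 p.2 : ℝ)|
  exact ⟨max 1 M, le_max_left 1 M, fun i j => le_max_of_le_right (hM ⟨(i, j), rfl⟩)⟩

theorem isBigO_maxGraverNorm_fourBlock (A : Matrix (Fin dA) (Fin nA) ℤ)
    (B : Matrix (Fin dA) (Fin nB) ℤ) (C : Matrix (Fin dC) (Fin nB) ℤ)
    (D : Matrix (Fin dC) (Fin nA) ℤ) :
    (fun N : ℕ => (maxGraverNorm (fourBlock N C D B A) : ℝ)) =O[Filter.atTop]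
      fun N : ℕ => (N : ℝ) ^ (2 ^ dC) := by
  obtain ⟨M, hM, hCD⟩ := exists_one_le_forall_abs_le (fromCols C D)
  have hE : (fun N : ℕ => (maxGraverNorm (fourBlock N C D B A) : ℝ)) =O[Filter.atTop]
      fun N : ℕ => (maxGraverNorm (twoStage N B A) : ℝ) ^ (2 ^ dC) := by
    refine Asymptotics.IsBigO.of_bound ((2 * M) ^ (2 ^ dC - 1)) (.of_forall fun N => ?_)
    rw [Real.norm_natCast, norm_pow, Real.norm_natCast]
    exact maxGraverNorm_fourBlock_le hM (fun i j => hCD i (.inl j)) (fun i j => hCD i (.inr j)) N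
  exact hE.trans ((isBigO_maxGraverNorm_twoStage A B).pow (2 ^ dC))

theorem maxGraverNorm_fourBlock_le_columns_mul {g : ℕ} (hg : IsTwoStageGraverBound A B g)
    (hM : 1 ≤ M) (hC : ∀ i j, |(C i j : ℝ)| ≤ M) (hD : ∀ i j, |(D i j : ℝ)| ≤ M) (N : ℕ) :
    (maxGraverNorm (fourBlock N C D B A) : ℝ) ≤
      (2 * ((nB : ℝ) + N * nA) * M) ^ (2 ^ dC - 1) *
        (maxGraverNorm (twoStage N B A) : ℝ) ^ (2 ^ dC) := by
  refine (maxGraverNorm_fourBlock_le hM hC hD N).trans ?_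
  rcases Nat.eq_zero_or_pos (maxGraverNorm (twoStage N B A)) with h0 | hpos
  · simp [h0]
  · have hcols : (1 : ℝ) ≤ nB + N * nA := by
      exact_mod_cast Nat.pos_of_mul_pos_right (hpos.trans_le (maxGraverNorm_twoStage_le hg N))
    gcongr
    linarith

end FourBlock

theorem mainTheorem5 {dA nA nB : ℕ} (A : Matrix (Fin dA) (Fin nA) ℤ)
    (B : Matrix (Fin dA) (Fin nB) ℤ) :
    -- a bound `g` that depends only on `A` and `B` exists
    (∃ g : ℕ, IsTwoStageGraverBound A B g) ∧
    ∀ {dC : ℕ} (C : Matrix (Fin dC) (Fin nB) ℤ) (D : Matrix (Fin dC) (Fin nA) ℤ),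
      -- the Graver bases are finite, so that the maxima below are maxima
      (∀ N : ℕ, (graverBasis (twoStage N B A)).Finite ∧
        (graverBasis (fourBlock N C D B A)).Finite) ∧
      -- the explicit bounds
      (∀ g : ℕ, IsTwoStageGraverBound A B g →
        ∀ M : ℝ, 1 ≤ M → (∀ i j, |(C i j : ℝ)| ≤ M) → (∀ i j, |(D i j : ℝ)| ≤ M) →
        ∀ N : ℕ,
          (maxGraverNorm (fourBlock N C D B A) : ℝ) ≤
              (2 * ((nB : ℝ) + N * nA) * M) ^ (2 ^ dC - 1) *
                (maxGraverNorm (twoStage N B A) : ℝ) ^ (2 ^ dC) ∧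
          (2 * ((nB : ℝ) + N * nA) * M) ^ (2 ^ dC - 1) *
                (maxGraverNorm (twoStage N B A) : ℝ) ^ (2 ^ dC) ≤
              (2 * ((nB : ℝ) + N * nA) * M) ^ (2 ^ dC - 1) *
                (((nB : ℝ) + N * nA) * g) ^ (2 ^ dC)) ∧
      -- the growth rate for fixed blocks
      (fun N : ℕ => (maxGraverNorm (fourBlock N C D B A) : ℝ)) =O[Filter.atTop]
        (fun N : ℕ => (N : ℝ) ^ (2 ^ dC + 1)) := by
  refine ⟨exists_isTwoStageGraverBound A B, fun {dC} C D =>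
    ⟨fun N => ⟨finite_graverBasis _, finite_graverBasis _⟩, fun g hg M hM hC hD N =>
      ⟨maxGraverNorm_fourBlock_le_columns_mul hg hM hC hD N, ?_⟩, ?_⟩⟩
  · gcongr
    exact_mod_cast maxGraverNorm_twoStage_le hg N
  · exact (isBigO_maxGraverNorm_fourBlock A B C D).trans
      ((Asymptotics.isBigO_pow_pow_cobounded_of_le (Nat.le_succ _)).comp_tendsto
        tendsto_natCast_atTop_cobounded)
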